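/- Let $H$ be a finite-dimensional Hopf algebra over $\mathbb{C}$, with comultiplication $\Delta(h)=\sum h_1\otimes h_2$, counit $\epsilon$ and antipode $S$. Suppose that the polynomial algebra $\mathbb{C}[x]$ is an $H$-module algebra, that is, $\mathbb{C}[x]$ is an $H$-module with $h1=\epsilon(h)1$ and $h(ab)=\sum (h_1a)(h_2b)$ for all $h\in H$ and $a,b\in\mathbb{C}[x]$. Suppose that the action is inner faithful: $I\,\mathbb{C}[x]\neq 0$ for every nonzero Hopf ideal $I$ of $H$, where a Hopf ideal is a two-sided ideal $I$ with $\Delta(I)\subseteq H\otimes I+I\otimes H$, $\epsilon(I)=0$ and $S(I)\subseteq I$. Suppose finally that, for some integer $m\ge 0$, the action of $H$ commutes with the derivation $x^m\frac{d}{dx}$ of $\mathbb{C}[x]$, that is, $h\left(x^m\frac{dp}{dx}\right)=x^m\frac{d(hp)}{dx}$ for all $h\in H$ and $p\in\mathbb{C}[x]$. Then $H$ is a group algebra: there is a group $G$ such that $H$ is isomorphic, as a Hopf algebra, to $\mathbb{C}[G]$ with its standard Hopf algebra structure. -/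

import Mathlib

open scoped Polynomial

/-- `A` is an `H`-module algebra for the `R`-bialgebra `H`: the `H`-module structure on `A`
(compatible with the `R`-linear structures) satisfies `h • 1 = ε(h) 1` and
`h • (a * b) = ∑ (h₁ • a) * (h₂ • b)`, where `Δ(h) = ∑ h₁ ⊗ h₂`. -/
class IsModuleAlgebra (R H A : Type*) [CommRing R] [Ring H] [Bialgebra R H] [Ring A] [Algebra R A]
    [Module H A] [IsScalarTower R H A] : Prop where
  smul_one_eq : ∀ h : H, h • (1 : A) = Coalgebra.counit (R := R) h • (1 : A)
  smul_mul_eq : ∀ (h : H) (a b : A),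
    h • (a * b) = LinearMap.mul' R A
      (TensorProduct.map ((LinearMap.toSpanSingleton H A a).restrictScalars R)
        ((LinearMap.toSpanSingleton H A b).restrictScalars R) (Coalgebra.comul (R := R) h))

/-- The `H`-module `M` is inner faithful: `I M ≠ 0` for every nonzero (two-sided)
Hopf ideal `I` of `H`. -/
def IsInnerFaithful (R H M : Type*) [CommRing R] [Ring H] [HopfAlgebra R H]
    [AddCommGroup M] [Module H M] : Prop :=
  ∀ I : Ideal H, I.IsTwoSided → I.IsHopfIdeal R → I ≠ ⊥ → ∃ h ∈ I, ∃ v : M, h • v ≠ 0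

/-- `H` is a group algebra: it is isomorphic, as a Hopf algebra over `R`, to `R[G]` with its
standard Hopf structure (every `g ∈ G` is group-like), for some group `G`. -/
def IsGroupAlgebra.{u, v} (R : Type u) (H : Type v) [CommRing R] [Ring H] [HopfAlgebra R H] :
    Prop :=
  ∃ (G : Type v) (_ : Group G) (e : H ≃ₐc[R] MonoidAlgebra R G),
    ∀ h : H, e (HopfAlgebra.antipode R h) = HopfAlgebra.antipode R (e h)

open Polynomial WithConv TensorProduct

/-! The core is that each `h` acts on `X` by a scalar `χ h` (`exists_smul_X_eq_smul`). Then `h` acts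
on `X ^ i` by the convolution power `χ ^ i`, so the common kernel of these powers annihilates
`ℂ[X]`. As `χ` has finite order, this kernel is a Hopf ideal, hence zero. The distinct powers of `χ`
then form a basis of the dual of `H`, and roots of unity yield enough group-like elements
(`isGroupAlgebra_of_powKer_eq_bot`).

For the scalar, put `D = X ^ m * d/dX`. If `m = 1`, `X` spans an eigenspace of `D`. If `m = 0`, `h -
ε(h)` sends `X` to a constant; a nonzero one would make it lower degrees like `d/dX`, which no
algebraic operator does. If `m = n + 1` with `n > 0`, the family `Q : h ↦ h • X ^ n` satisfies `X ^
(n + 1) * Q' = n * Q ^ 2` in the convolution algebra. Formally `1 / Q = X ^ (-n) + c` with `c`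
constant (`exists_linear_of_convDerivative_eq`). This confines `h • X` to degrees `1 + i * n`, the
`D`-cyclic space of `X`. So `h • X = g(D) X`, and algebraicity forces `g` to be constant. -/

/-- Two polynomials with vanishing Wronskian are proportional. -/
theorem Polynomial.eq_C_mul_of_derivative_mul_eq {k : Type*} [Field k] [CharZero k] {f g : k[X]}
    (hg : g ≠ 0) (h : derivative f * g = f * derivative g) :
    f = C (f.coeff g.natDegree / g.leadingCoeff) * g := by
  set c := f.coeff g.natDegree / g.leadingCoeff
  have hlc : g.leadingCoeff ≠ 0 := leadingCoeff_ne_zero.2 hg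
  by_contra hne
  -- By the choice of `c`, `w` has no term in degree `g.natDegree`; comparing top coefficients in
  -- its Wronskian with `g` forces exactly that degree on `w`.
  set w := f - C c * g with hw
  have hw0 : w ≠ 0 := sub_ne_zero.2 hne
  have hW : derivative w * g = w * derivative g := by
    simp only [hw, derivative_sub, derivative_C_mul]
    linear_combination h
  have hcoeff : w.coeff g.natDegree = 0 := by
    simp only [hw, coeff_sub, coeff_C_mul, c, coeff_natDegree]
    field_simp
    ring
  have key := congrArg (fun p => (X * p).coeff (w.natDegree + g.natDegree)) hW
  have e1 : ∀ p : k[X], (X * derivative p).coeff p.natDegree = p.natDegree * p.leadingCoeff := by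
    intro p
    rcases hp : p.natDegree with _ | d
    · simp
    · rw [coeff_X_mul, coeff_derivative, leadingCoeff, hp]; push_cast; ring
  have e2 : ∀ p : k[X], (X * derivative p).natDegree ≤ p.natDegree := by
    intro p
    rcases eq_or_ne (derivative p) 0 with h0 | h0
    · simp [h0]
    · rw [natDegree_X_mul h0]
      exact natDegree_derivative_lt (fun h => h0 (derivative_of_natDegree_zero h))
  rw [← mul_assoc, mul_left_comm, coeff_mul_add_eq_of_natDegree_le (e2 w) le_rfl,
    coeff_mul_add_eq_of_natDegree_le le_rfl (e2 g), e1, e1, coeff_natDegree, coeff_natDegree] at key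
  have hlw : w.leadingCoeff ≠ 0 := leadingCoeff_ne_zero.2 hw0
  have : (w.natDegree : k) = g.natDegree := by
    apply mul_right_cancel₀ (mul_ne_zero hlw hlc)
    linear_combination key
  have : w.natDegree = g.natDegree := by exact_mod_cast this
  rw [← this, coeff_natDegree] at hcoeff
  exact hlw hcoeff

theorem Commute.aeval_left {R A : Type*} [CommSemiring R] [Semiring A] [Algebra R A] {a b : A}
    (h : Commute a b) (q : R[X]) : Commute (aeval a q) b := by
  rw [aeval_eq_sum_range]
  exact Commute.sum_left _ _ _ fun i _ => (h.pow_left i).smul_left _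

/-! ### Operators commuting with `d/dX`. -/

section Derivative

variable {k : Type*} [Field k] [CharZero k]

/-- The kernel of an operator commuting with `d/dx`, killing `1` and sending `X` to a nonzero
constant consists of constants. -/
theorem derivative_eq_zero_of_commute_apply_eq_zero (T : Module.End k k[X])
    (hT : ∀ p, T (derivative p) = derivative (T p)) (h1 : T 1 = 0) {c : k} (hc : c ≠ 0)
    (hX : T X = C c) {f : k[X]} (hf : T f = 0) : derivative f = 0 := by
  induction hd : f.natDegree using Nat.strong_induction_on generalizing f with
  | _ d ih =>
    rcases eq_or_ne f.natDegree 0 with h0 | h0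
    · exact derivative_of_natDegree_zero h0
    -- The kernel is stable under `d/dX`, so induction on the degree leaves only affine `f`.
    have h2 : derivative (derivative f) = 0 :=
      ih _ (hd ▸ natDegree_derivative_lt h0) (by rw [hT, hf, derivative_zero]) rfl
    have hb : derivative f = C ((derivative f).coeff 0) := eq_C_of_derivative_eq_zero h2
    set b := (derivative f).coeff 0
    have hfa : f - b • X = C ((f - b • X).coeff 0) := by
      apply eq_C_of_derivative_eq_zero
      rw [derivative_sub, derivative_smul, derivative_X, hb, smul_eq_C_mul, mul_one, sub_self]
    have h3 : T (f - b • X) = 0 := by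
      rw [hfa, ← mul_one (C _), ← smul_eq_C_mul, map_smul, h1, smul_zero]
    rw [map_sub, hf, map_smul, hX, zero_sub, neg_eq_zero, smul_eq_zero, C_eq_zero] at h3
    rw [hb, h3.resolve_right hc, C_0]

/-- An algebraic operator commuting with `d/dx` and killing `1` cannot send `X` to a nonzero
constant. -/
theorem eq_zero_of_commute_derivative_of_isAlgebraic (T : Module.End k k[X])
    (hT : ∀ p, T (derivative p) = derivative (T p)) (h1 : T 1 = 0) {c : k}
    (hX : T X = C c) (halg : IsAlgebraic k T) : c = 0 := by
  by_contra hc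
  have hcomm : Commute T (derivative : Module.End k k[X]) := LinearMap.ext hT
  have hker : ∀ (j : ℕ) (f : k[X]), (T ^ j) f = 0 →
      ((derivative : Module.End k k[X]) ^ j) f = 0 := by
    intro j
    induction j with
    | zero => simp
    | succ j ih =>
      intro f hf
      rw [pow_succ, Module.End.mul_apply] at hf
      have := ih _ hf
      rw [← Module.End.mul_apply, ← (hcomm.pow_right j).eq, Module.End.mul_apply] at this
      rw [pow_succ', Module.End.mul_apply]
      exact derivative_eq_zero_of_commute_apply_eq_zero T hT h1 hc hX this
  obtain ⟨p, hp0, hp⟩ := halg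
  -- Write `p = X ^ j * q` with `q(0) ≠ 0` and test on `X ^ j`: the `j`-th derivative of `q(T) X ^
  -- j` must vanish, yet it equals `j! * q(0)`.
  obtain ⟨q, hpq, hq⟩ := exists_eq_pow_rootMultiplicity_mul_and_not_dvd p hp0 0
  simp only [C_0, sub_zero, X_dvd_iff] at hpq hq
  generalize rootMultiplicity 0 p = j at hpq
  have h2 : (T ^ j) (aeval T q (X ^ j)) = 0 := by
    rw [← Module.End.mul_apply, ← aeval_X_pow (R := k), ← map_mul, ← hpq, hp, LinearMap.zero_apply]
  have h3 := hker _ _ h2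
  have hcq : Commute (aeval T q) ((derivative : Module.End k k[X]) ^ j) :=
    (hcomm.aeval_left q).pow_right j
  rw [← Module.End.mul_apply, ← hcq.eq, Module.End.mul_apply, Module.End.pow_apply,
    iterate_derivative_X_pow_eq_smul] at h3
  have h4 : aeval T q (1 : k[X]) = C (q.coeff 0) := by
    rw [aeval_eq_sum_range, LinearMap.sum_apply, Finset.sum_eq_single 0]
    · simp [smul_eq_C_mul]
    · intro b _ hb
      obtain ⟨b, rfl⟩ := Nat.exists_eq_succ_of_ne_zero hb
      simp [pow_succ, h1]
    · simp
  simp [Nat.descFactorial_self, h4, hq, Nat.factorial_ne_zero] at h3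

end Derivative

/-! ### Orbit maps in the convolution algebra. -/

section Coaction

variable {R H A : Type*} [CommRing R] [Ring H]

/-- An element `a` of an `H`-module algebra, viewed as the linear map `h ↦ h • a`. -/
def orbitMap (R H : Type*) {A : Type*} [CommRing R] [Ring H] [Algebra R H] [AddCommGroup A]
    [Module R A] [Module H A] [IsScalarTower R H A] (a : A) : WithConv (H →ₗ[R] A) :=
  toConv ((LinearMap.toSpanSingleton H A a).restrictScalars R)

@[simp] theorem orbitMap_apply [Algebra R H] [AddCommGroup A] [Module R A] [Module H A]
    [IsScalarTower R H A] (a : A) (h : H) : orbitMap R H a h = h • a := rfl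

section

variable [Bialgebra R H] [Ring A] [Algebra R A] [Module H A] [IsScalarTower R H A]
  [IsModuleAlgebra R H A]

theorem orbitMap_mul (a b : A) : orbitMap R H (a * b) = orbitMap R H a * orbitMap R H b :=
  WithConv.ext (LinearMap.ext fun h => IsModuleAlgebra.smul_mul_eq h a b)

theorem orbitMap_one : orbitMap R H (1 : A) = 1 :=
  WithConv.ext (LinearMap.ext fun h => by
    rw [LinearMap.convOne_apply, Algebra.algebraMap_eq_smul_one]
    exact IsModuleAlgebra.smul_one_eq h)

end

/-- The action of `H` on `M` as an algebra homomorphism to the endomorphisms. -/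
def smulAlgHom (R H M : Type*) [CommRing R] [Ring H] [Algebra R H] [AddCommGroup M] [Module R M]
    [Module H M] [IsScalarTower R H M] : H →ₐ[R] Module.End R M :=
  letI : SMulCommClass H R M := IsScalarTower.to_smulCommClass'
  Algebra.lsmul R R M

@[simp] theorem smulAlgHom_apply {M : Type*} [Algebra R H] [AddCommGroup M] [Module R M]
    [Module H M] [IsScalarTower R H M] (h : H) (m : M) : smulAlgHom R H M h m = h • m := rfl

variable [HopfAlgebra R H]

theorem AlgHom.comp_antipode_convMul {B : Type*} [Ring B] [Algebra R B] (f : H →ₐ[R] B) :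
    toConv (f.toLinearMap ∘ₗ HopfAlgebra.antipode R) * toConv f.toLinearMap = 1 := by
  have := LinearMap.algHom_comp_convMul_distrib f (toConv (HopfAlgebra.antipode R (A := H)))
    (toConv LinearMap.id)
  rw [LinearMap.antipode_mul_id] at this
  refine WithConv.ext (Eq.trans this.symm (LinearMap.ext fun h => by simp))

theorem AlgHom.convMul_comp_antipode {B : Type*} [Ring B] [Algebra R B] (f : H →ₐ[R] B) :
    toConv f.toLinearMap * toConv (f.toLinearMap ∘ₗ HopfAlgebra.antipode R) = 1 := by
  have := LinearMap.algHom_comp_convMul_distrib f (toConv LinearMap.id)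
    (toConv (HopfAlgebra.antipode R (A := H)))
  rw [LinearMap.id_mul_antipode] at this
  refine WithConv.ext (Eq.trans this.symm (LinearMap.ext fun h => by simp))

variable [Ring A] [Algebra R A] [Module H A] [IsScalarTower R H A] [IsModuleAlgebra R H A]

/-- If left multiplication by `a` is injective, then so is left convolution by `h ↦ h • a`. -/
theorem eq_zero_of_orbitMap_mul_eq_zero {a : A} (ha : IsLeftRegular a)
    {f : WithConv (H →ₗ[R] A)} (hf : orbitMap R H a * f = 0) : f = 0 := by
  let μ : A →ₐ[R] Module.End R A := Algebra.lmul R A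
  let push : WithConv (H →ₗ[R] A) → WithConv (H →ₗ[R] Module.End R A) :=
    fun g => toConv (μ.toLinearMap ∘ₗ g.ofConv)
  have hpush : ∀ g g', push (g * g') = push g * push g' := fun g g' =>
    WithConv.ext (LinearMap.algHom_comp_convMul_distrib μ g g')
  let l : WithConv (H →ₗ[R] Module.End R A) := toConv (smulAlgHom R H A).toLinearMap
  let l' : WithConv (H →ₗ[R] Module.End R A) :=
    toConv ((smulAlgHom R H A).toLinearMap ∘ₗ HopfAlgebra.antipode R)
  let c : WithConv (H →ₗ[R] Module.End R A) :=
    toConv (LinearMap.toSpanSingleton R _ (μ a) ∘ₗ Coalgebra.counit)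
  have hll' : l * l' = 1 := AlgHom.convMul_comp_antipode _
  have hl'l : l' * l = 1 := AlgHom.comp_antipode_convMul _
  -- The module-algebra axiom for `h • (a * b)`, read as an identity of operators on `b`: the action
  -- conjugates the constant family `c` into the orbit of `a`, so regularity transfers.
  have hconj : push (orbitMap R H a) * l = l * c := by
    ext h b
    let 𝓡 := Coalgebra.Repr.arbitrary R h
    have h1 : h • (a * b) = _ := congrArg (fun f => f.ofConv h) (orbitMap_mul (R := R) (H := H) a b)
    rw [𝓡.convMul_apply] at h1
    rw [𝓡.convMul_apply, 𝓡.convMul_apply]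
    have h2 : h = ∑ i ∈ 𝓡.index, Coalgebra.counit (R := R) (𝓡.right i) • 𝓡.left i := by
      simpa only [map_sum, TensorProduct.rid_tmul, one_smul] using
        congrArg (TensorProduct.rid R H) (Coalgebra.sum_tmul_counit_eq 𝓡).symm
    simp only [LinearMap.sum_apply, Module.End.mul_apply]
    refine Eq.trans h1.symm ?_
    nth_rewrite 1 [h2]
    rw [Finset.sum_smul]
    refine Finset.sum_congr rfl fun i _ => ?_
    simp [l, c, μ]
  have hc : ∀ g, c * g = 0 → g = 0 := by
    intro g hg
    ext h b
    apply ha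
    have : (c * g) h b = a * g h b := by
      let 𝓡 := Coalgebra.Repr.arbitrary R h
      have h2 : h = ∑ i ∈ 𝓡.index, Coalgebra.counit (R := R) (𝓡.left i) • 𝓡.right i :=
        (Coalgebra.sum_counit_smul 𝓡).symm
      rw [𝓡.convMul_apply]
      refine Eq.trans ?_ (congrArg (fun x => a * g x b) h2).symm
      simp [c, μ, Finset.mul_sum]
    rw [hg] at this
    simpa using this.symm
  have h1 : c * (l' * push f) = 0 := by
    have : c = l' * push (orbitMap R H a) * l := by
      rw [mul_assoc, hconj, ← mul_assoc, hl'l, one_mul]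
    rw [this, mul_assoc, ← mul_assoc l, hll', one_mul, mul_assoc, ← hpush, hf]
    have : push 0 = 0 := by ext; simp [push]
    rw [this, mul_zero]
  have h2 : push f = 0 := by
    rw [← one_mul (push f), ← hll', mul_assoc, hc _ h1, mul_zero]
  ext h
  simpa [push, μ] using congrArg (fun g => g.ofConv h 1) h2

end Coaction

/-- A left regular algebraic element divides a nonzero scalar, with a commuting cofactor. -/
theorem IsAlgebraic.exists_mul_eq_algebraMap {R S : Type*} [CommRing R] [Ring S] [Algebra R S]
    {s : S} (hs : IsAlgebraic R s) (hreg : ∀ t, s * t = 0 → t = 0) :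
    ∃ r : R, r ≠ 0 ∧ ∃ t : S, s * t = algebraMap R S r ∧ t * s = algebraMap R S r := by
  obtain ⟨p, hp0, hp⟩ := hs
  obtain ⟨q, hpq, hq⟩ := exists_eq_pow_rootMultiplicity_mul_and_not_dvd p hp0 0
  simp only [C_0, sub_zero, X_pow_mul, X_dvd_iff] at hpq hq
  have hpow : ∀ (n : ℕ) (t : S), s ^ n * t = 0 → t = 0 := by
    intro n
    induction n with
    | zero => simp
    | succ n ih => exact fun t ht => hreg t (ih _ (by rw [← mul_assoc, ← pow_succ, ht]))
  have hq0 : aeval s q = 0 := by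
    refine hpow (rootMultiplicity 0 p) _ ?_
    rw [← aeval_X_pow (R := R), ← map_mul, X_pow_mul, ← hpq, hp]
  obtain ⟨u, hu⟩ := X_dvd_sub_C (p := q)
  have h1 : s * aeval s u = algebraMap R S (-q.coeff 0) := by
    have := congrArg (aeval s) hu
    rw [map_sub, hq0, zero_sub, map_mul, aeval_X, aeval_C, ← map_neg] at this
    exact this.symm
  exact ⟨_, neg_ne_zero.2 hq, aeval s u, h1, by rw [← h1, ((Commute.refl s).aeval_left u).eq]⟩

/-! ### Differential equations for families of polynomials. -/

section ConvPolynomial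

variable {k H : Type*} [Field k]

section Coalgebra

variable [AddCommGroup H] [Module k H]

instance LinearMap.finite_withConv {A : Type*} [CommRing A] [Algebra k A]
    [FiniteDimensional k H] : Module.Finite A (WithConv (H →ₗ[k] A)) :=
  Module.Finite.equiv (((Module.finBasis k H).constr A).trans (WithConv.linearEquiv A _).symm)

/-- Coefficientwise derivative of a family of polynomials. -/
noncomputable def convDerivative (f : WithConv (H →ₗ[k] k[X])) : WithConv (H →ₗ[k] k[X]) :=
  toConv (derivative ∘ₗ f.ofConv)

@[simp] theorem convDerivative_apply (f : WithConv (H →ₗ[k] k[X])) (h : H) :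
    convDerivative f h = derivative (f h) := rfl

variable [Coalgebra k H]

theorem convDerivative_mul (f g : WithConv (H →ₗ[k] k[X])) :
    convDerivative (f * g) = convDerivative f * g + f * convDerivative g := by
  ext1; ext1 h
  let 𝓡 := Coalgebra.Repr.arbitrary k h
  rw [convDerivative_apply, WithConv.ofConv_add, LinearMap.add_apply, 𝓡.convMul_apply,
    𝓡.convMul_apply, 𝓡.convMul_apply, derivative_sum, ← Finset.sum_add_distrib]
  exact Finset.sum_congr rfl fun i _ => derivative_mul

theorem convDerivative_algebraMap (s : k[X]) :
    convDerivative (algebraMap k[X] (WithConv (H →ₗ[k] k[X])) s) = algebraMap _ _ (derivative s) := by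
  ext1; ext1 h
  simp [mul_comm _ (C _)]

theorem X_pow_smul_injective (n : ℕ) {f g : WithConv (H →ₗ[k] k[X])}
    (h : (X ^ n : k[X]) • f = (X ^ n : k[X]) • g) : f = g := by
  ext1; ext1 x
  have := congrArg (fun f => f.ofConv x) h
  exact mul_left_cancel₀ (pow_ne_zero n X_ne_zero) this

variable [CharZero k]

/-- A regular solution of `X ^ (n + 1) * Q' = n * Q ^ 2` in the convolution algebra satisfies
`(1 + c * X ^ n) * Q = X ^ n` for some family of constants `c`. -/
theorem exists_linear_of_convDerivative_eq [FiniteDimensional k H] (n : ℕ)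
    (Q : WithConv (H →ₗ[k] k[X]))
    (hreg : ∀ f, Q * f = 0 → f = 0)
    (hQ : (X ^ (n + 1) : k[X]) • convDerivative Q = (n : k[X]) • (Q * Q)) :
    ∃ c : H →ₗ[k] k,
      Q + (X ^ n : k[X]) • (toConv (Algebra.linearMap k k[X] ∘ₗ c) * Q) = algebraMap k[X] _ (X ^ n) := by
  have halg : IsAlgebraic k[X] Q := (IsIntegral.of_finite k[X] Q).isAlgebraic
  obtain ⟨s, hs0, U, hQU, hUQ⟩ := halg.exists_mul_eq_algebraMap hreg
  -- Differentiate `Q * U = s` and multiply by `U` on the left, the side on which `U * Q = s`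
  -- applies; then substitute `hQ`.
  have hmain : (n : k[X]) • (s ^ 2 • (1 : WithConv (H →ₗ[k] k[X]))) +
      (X ^ (n + 1) : k[X]) • (s • convDerivative U) =
      (X ^ (n + 1) : k[X]) • (derivative s • U) := by
    have h1 : U * convDerivative (Q * U) = derivative s • U := by
      rw [hQU, convDerivative_algebraMap, ← Algebra.commutes, ← Algebra.smul_def]
    rw [convDerivative_mul, mul_add, ← mul_assoc U Q, hUQ, ← Algebra.smul_def] at h1
    rw [← h1, smul_add]
    congr 1
    rw [← mul_smul_comm, ← smul_mul_assoc, hQ, smul_mul_assoc, mul_smul_comm, mul_assoc Q, hQU,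
      ← mul_assoc, hUQ, ← map_mul, Algebra.algebraMap_eq_smul_one, sq]
  -- Formally `w / (X ^ n * s) = 1 / Q - X ^ (-n)`, which should be constant; `hmain` is the
  -- vanishing of the corresponding Wronskian.
  let w : H →ₗ[k] k[X] :=
    LinearMap.mulLeft k (X ^ n) ∘ₗ U.ofConv -
      LinearMap.mulLeft k s ∘ₗ (1 : WithConv (H →ₗ[k] k[X])).ofConv
  have hg : X ^ n * s ≠ 0 := mul_ne_zero (pow_ne_zero n X_ne_zero) hs0
  let c : H →ₗ[k] k := (X ^ n * s).leadingCoeff⁻¹ • (lcoeff k (X ^ n * s).natDegree ∘ₗ w)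
  refine ⟨c, ?_⟩
  have hw : ∀ h, w h = C (c h) * (X ^ n * s) := by
    intro h
    have h1 : (n : k[X]) * (s ^ 2 * C (Coalgebra.counit (R := k) h)) +
      X ^ (n + 1) * (s * derivative (U h)) = X ^ (n + 1) * (derivative s * U h) :=
      congrArg (fun f => f.ofConv h) hmain
    have hwh : w h = X ^ n * U h - s * C (Coalgebra.counit (R := k) h) := rfl
    have key : derivative (w h) * (X ^ n * s) = w h * derivative (X ^ n * s) := by
      apply mul_left_cancel₀ (X_ne_zero (R := k))
      rw [hwh]
      simp only [derivative_sub, derivative_mul, derivative_X_pow, derivative_C]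
      rcases n with _ | n
      · simp at h1 ⊢
        linear_combination h1
      · simp only [Nat.add_sub_cancel, map_natCast] at h1 ⊢
        linear_combination X ^ (n + 1) * h1
    rw [eq_C_mul_of_derivative_mul_eq hg key]
    congr 2
    simp only [c, LinearMap.smul_apply, LinearMap.comp_apply, lcoeff_apply, smul_eq_mul]
    field_simp
  have hU : (X ^ n : k[X]) • U =
      s • (1 + (X ^ n : k[X]) • toConv (Algebra.linearMap k k[X] ∘ₗ c)) := by
    ext1; ext1 h
    change X ^ n * U h = s * (C (Coalgebra.counit (R := k) h) + X ^ n * C (c h))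
    have hwh : w h = X ^ n * U h - s * C (Coalgebra.counit (R := k) h) := rfl
    linear_combination hw h - hwh
  have h2 : s • (Q + (X ^ n : k[X]) • (toConv (Algebra.linearMap k k[X] ∘ₗ c) * Q)) =
      s • algebraMap k[X] _ (X ^ n) := by
    have := congrArg (· * Q) hU
    simp only [smul_mul_assoc, add_mul, one_mul, hUQ] at this
    rw [← this, Algebra.algebraMap_eq_smul_one, Algebra.algebraMap_eq_smul_one, smul_comm]
  ext1; ext1 h
  exact mul_left_cancel₀ hs0 (congrArg (fun f => f.ofConv h) h2)

/-- Support of a polynomial family `P` with `P = X * P' + X ^ (n + 1) * c * P'`. -/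
theorem coeff_eq_zero_of_eq_convDerivative (n : ℕ) (hn : 0 < n) (P : WithConv (H →ₗ[k] k[X]))
    (c : H →ₗ[k] k)
    (hP : P = (X : k[X]) • convDerivative P +
      (X ^ (n + 1) : k[X]) • (toConv (Algebra.linearMap k k[X] ∘ₗ c) * convDerivative P))
    (j : ℕ) (hj : ∀ i, j ≠ 1 + i * n) (h : H) : (P h).coeff j = 0 := by
  induction j using Nat.strong_induction_on generalizing h with
  | _ j ih =>
    have h1 : P h = X * derivative (P h) + X ^ (n + 1) *
      (toConv (Algebra.linearMap k k[X] ∘ₗ c) * convDerivative P) h :=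
      congrArg (fun f => f.ofConv h) hP
    have h2 := congrArg (fun f => f.coeff j) h1
    have e1 : (X * derivative (P h)).coeff j = (P h).coeff j * j := by
      rcases j with _ | j
      · simp
      · rw [coeff_X_mul, coeff_derivative]; push_cast; rfl
    have e2 : (X ^ (n + 1) *
      (toConv (Algebra.linearMap k k[X] ∘ₗ c) * convDerivative P) h).coeff j = 0 := by
      rw [coeff_X_pow_mul']
      split_ifs with hle
      · let 𝓡 := Coalgebra.Repr.arbitrary k h
        rw [𝓡.convMul_apply, finsetSum_coeff]
        refine Finset.sum_eq_zero fun i _ => ?_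
        have h3 : (convDerivative P (𝓡.right i)).coeff (j - (n + 1)) = 0 := by
          rw [convDerivative_apply, coeff_derivative]
          rw [ih _ (by omega), zero_mul]
          intro i hi
          apply hj (i + 1)
          rw [add_mul]
          omega
        change (C _ * _).coeff _ = 0
        rw [coeff_C_mul, h3, mul_zero]
      · rfl
    simp only [coeff_add, e1, e2, add_zero] at h2
    -- The factor `j - 1` vanishes only at `j = 1`, the allowed degree with `i = 0`.
    have h4 : (P h).coeff j * ((j : k) - 1) = 0 := by linear_combination -h2
    refine (mul_eq_zero.1 h4).resolve_right fun h5 => hj 0 ?_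
    have : (j : k) = (1 : ℕ) := by push_cast; linear_combination h5
    simpa using Nat.cast_injective this

end Coalgebra

variable [CharZero k] [Ring H] [HopfAlgebra k H] [FiniteDimensional k H] [Module H k[X]]
  [IsScalarTower k H k[X]] [IsModuleAlgebra k H k[X]]

/-- With `P`, `Q` the orbits of `X`, `X ^ n`, applying `D` to `X` and `X ^ n` gives `X ^ (n + 1) *
P' = Q * P` and the quadratic equation for `Q`. Multiplying the solved relation for `Q` by `P`
eliminates `Q`. -/
theorem coeff_smul_X_eq_zero (n : ℕ) (hn : 0 < n)
    (hcomm : ∀ (h : H) (p : k[X]),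
      h • (X ^ (n + 1) * derivative p) = X ^ (n + 1) * derivative (h • p))
    (h : H) (j : ℕ) (hj : ∀ i, j ≠ 1 + i * n) : (h • (X : k[X])).coeff j = 0 := by
  have hD : ∀ p : k[X], orbitMap k H (X ^ (n + 1) * derivative p) =
      (X ^ (n + 1) : k[X]) • convDerivative (orbitMap k H p) := fun p => by
    ext1; ext1 h; exact hcomm h p
  have hPD : (X ^ (n + 1) : k[X]) • convDerivative (orbitMap k H X) =
      orbitMap k H (X ^ n) * orbitMap k H (X : k[X]) := by
    rw [← hD, derivative_X, mul_one, pow_succ, orbitMap_mul]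
  have hQD : (X ^ (n + 1) : k[X]) • convDerivative (orbitMap k H (X ^ n)) =
      (n : k[X]) • (orbitMap k H (X ^ n) * orbitMap k H (X ^ n)) := by
    rw [← hD, ← orbitMap_mul]
    ext1; ext1 h
    change h • _ = (n : k[X]) * h • _
    rw [← nsmul_eq_mul, ← orbitMap_apply (R := k), ← smulAlgHom_apply (R := k) h (X ^ n * X ^ n),
      ← map_nsmul, smulAlgHom_apply]
    refine congrArg (fun p : k[X] => h • p) ?_
    rw [derivative_X_pow, map_natCast, nsmul_eq_mul]
    obtain ⟨n, rfl⟩ := Nat.exists_eq_succ_of_ne_zero hn.ne'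
    simp only [Nat.succ_eq_add_one, Nat.add_sub_cancel]
    ring
  obtain ⟨c, hc⟩ := exists_linear_of_convDerivative_eq n (orbitMap k H (X ^ n))
    (fun f => eq_zero_of_orbitMap_mul_eq_zero (IsLeftRegular.pow n (isRegular_X.left))) hQD
  refine coeff_eq_zero_of_eq_convDerivative n hn (orbitMap k H X) c ?_ j hj h
  apply X_pow_smul_injective n
  have h1 := congrArg (· * orbitMap k H (X : k[X])) hc
  simp only [add_mul, smul_mul_assoc, mul_assoc, ← hPD, ← Algebra.smul_def] at h1
  rw [← h1, smul_add, smul_smul, ← pow_succ, mul_smul_comm]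

end ConvPolynomial

/-! ### The cyclic subspace generated by `X`. -/

section CyclicVector

variable {k : Type*} [Field k]

/-- The derivation `X ^ m * d/dX` of `k[X]`. -/
noncomputable def powDerivative (k : Type*) [Field k] (m : ℕ) : Module.End k k[X] :=
  LinearMap.mulLeft k (X ^ m) ∘ₗ derivative

theorem powDerivative_apply (m : ℕ) (p : k[X]) :
    powDerivative k m p = X ^ m * derivative p := rfl

theorem powDerivative_pow_apply_X (n i : ℕ) :
    (powDerivative k (n + 1) ^ i) X =
      C (∏ l ∈ Finset.range i, (1 + l * n : k)) * X ^ (1 + i * n) := by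
  induction i with
  | zero => simp
  | succ i ih =>
    rw [pow_succ', Module.End.mul_apply, ih, powDerivative_apply, derivative_C_mul,
      derivative_X_pow, Finset.prod_range_succ, C_mul, Nat.add_sub_cancel_left]
    push_cast
    ring

theorem coeff_aeval_powDerivative (n : ℕ) (hn : 0 < n) (g : k[X]) (i : ℕ) :
    (aeval (powDerivative k (n + 1)) g (X : k[X])).coeff (1 + i * n) =
      g.coeff i * ∏ l ∈ Finset.range i, (1 + l * n : k) := by
  induction g using Polynomial.induction_on' with
  | add p q hp hq => rw [map_add, LinearMap.add_apply, coeff_add, hp, hq, coeff_add, add_mul]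
  | monomial j a =>
    rw [aeval_monomial, Module.End.mul_apply, powDerivative_pow_apply_X,
      Module.algebraMap_end_apply, coeff_smul, coeff_C_mul, coeff_X_pow, coeff_monomial, smul_eq_mul]
    by_cases hij : j = i
    · simp [hij]
    · have : ¬ (1 + i * n = 1 + j * n) := fun h =>
        hij (Nat.eq_of_mul_eq_mul_right hn (by omega))
      rw [if_neg this, if_neg hij, mul_zero, mul_zero, zero_mul]

variable [CharZero k]

theorem prod_one_add_mul_ne_zero (n i : ℕ) :
    ∏ l ∈ Finset.range i, (1 + l * n : k) ≠ 0 := by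
  refine Finset.prod_ne_zero_iff.2 fun l _ => ?_
  have : ((1 + l * n : ℕ) : k) ≠ 0 := Nat.cast_ne_zero.2 (by omega)
  exact_mod_cast this

theorem eq_zero_of_aeval_powDerivative_eq_zero (n : ℕ) (hn : 0 < n) {g : k[X]}
    (hg : aeval (powDerivative k (n + 1)) g (X : k[X]) = 0) : g = 0 := by
  ext i
  have := coeff_aeval_powDerivative n hn g i
  rw [hg, coeff_zero] at this
  exact (mul_eq_zero.1 this.symm).resolve_right (prod_one_add_mul_ne_zero n i)

theorem exists_aeval_powDerivative_eq (n : ℕ) (f : k[X])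
    (hf : ∀ j, (∀ i, j ≠ 1 + i * n) → f.coeff j = 0) :
    ∃ g : k[X], aeval (powDerivative k (n + 1)) g (X : k[X]) = f := by
  let φ : k[X] →ₗ[k] k[X] :=
    LinearMap.applyₗ (R := k) (X : k[X]) ∘ₗ (aeval (powDerivative k (n + 1))).toLinearMap
  suffices h : f ∈ LinearMap.range φ from h
  rw [f.as_sum_support]
  refine Submodule.sum_mem _ fun j hj => ?_
  have : ∃ i, j = 1 + i * n := by
    by_contra! h
    exact mem_support_iff.1 hj (hf j h)
  obtain ⟨i, rfl⟩ := this
  refine ⟨monomial i (f.coeff (1 + i * n) / ∏ l ∈ Finset.range i, (1 + l * n : k)), ?_⟩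
  change aeval (powDerivative k (n + 1)) (monomial _ _) (X : k[X]) = _
  rw [aeval_monomial, Module.End.mul_apply, powDerivative_pow_apply_X,
    Module.algebraMap_end_apply, smul_eq_C_mul, ← mul_assoc, ← C_mul,
    div_mul_cancel₀ _ (prod_one_add_mul_ne_zero n i), C_mul_X_pow_eq_monomial]

/-- An algebraic operator commuting with `X ^ (n + 1) * d/dX` and preserving its cyclic subspace
generated by `X` acts on `X` by a scalar. -/
theorem exists_apply_X_eq_smul (n : ℕ) (hn : 0 < n) (T : Module.End k k[X])
    (hT : Commute T (powDerivative k (n + 1))) (halg : IsAlgebraic k T)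
    (hX : ∀ j, (∀ i, j ≠ 1 + i * n) → (T X).coeff j = 0) : ∃ c : k, T X = c • X := by
  obtain ⟨g, hg⟩ := exists_aeval_powDerivative_eq n (T X) hX
  obtain ⟨p, hp0, hp⟩ := halg
  set D := powDerivative k (n + 1)
  -- Since `T` commutes with `D`, it acts on `k[D] X` as `g(D)`. This module is free, so `p(T) = 0`
  -- gives `p ∘ g = 0`.
  have hTp : ∀ q : k[X], aeval T q (X : k[X]) = aeval D (q.comp g) (X : k[X]) := by
    intro q
    induction q using Polynomial.induction_on with
    | C a => simp
    | add p q hp hq => simp [hp, hq]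
    | monomial j a ih =>
      rw [pow_succ, ← mul_assoc]
      generalize C a * X ^ j = r at ih ⊢
      rw [map_mul, aeval_X, Module.End.mul_apply, ← hg, mul_X_comp, mul_comm (r.comp g), map_mul,
        Module.End.mul_apply, ← ih, ← Module.End.mul_apply, ← Module.End.mul_apply]
      exact congrArg (fun S : Module.End k k[X] => S X)
        ((hT.aeval_left _).symm.aeval_left g).eq.symm
  have hcomp : p.comp g = 0 :=
    eq_zero_of_aeval_powDerivative_eq_zero n hn (by rw [← hTp, hp, LinearMap.zero_apply])
  have hgC := ((comp_eq_zero_iff.1 hcomp).resolve_left hp0).2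
  refine ⟨g.coeff 0, ?_⟩
  rw [← hg, hgC, aeval_C, Module.algebraMap_end_apply, coeff_C_zero]

end CyclicVector

/-- A finite-dimensional Hopf algebra acting on `k[X]` and commuting with `X ^ m * d/dX` acts on
`X` by scalars. -/
theorem exists_smul_X_eq_smul {k H : Type*} [Field k] [CharZero k] [Ring H] [HopfAlgebra k H]
    [FiniteDimensional k H] [Module H k[X]] [IsScalarTower k H k[X]] [IsModuleAlgebra k H k[X]]
    (m : ℕ) (hcomm : ∀ (h : H) (p : k[X]),
      h • (X ^ m * derivative p) = X ^ m * derivative (h • p)) (h : H) :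
    ∃ c : k, h • (X : k[X]) = c • X := by
  have halg : ∀ h : H, IsAlgebraic k (smulAlgHom k H k[X] h) := fun h =>
    ((IsIntegral.of_finite k h).map (smulAlgHom k H k[X])).isAlgebraic
  have hone : h • (1 : k[X]) = C (Coalgebra.counit (R := k) h) := by
    rw [IsModuleAlgebra.smul_one_eq (R := k), smul_eq_C_mul, mul_one]
  rcases m with _ | _ | n
  · simp only [pow_zero, one_mul] at hcomm
    refine ⟨Coalgebra.counit (R := k) h, ?_⟩
    set T := smulAlgHom k H k[X] (h - algebraMap k H (Coalgebra.counit h)) with hTdef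
    have hTa : ∀ p, T p = h • p - (Coalgebra.counit (R := k) h) • p := fun p => by
      rw [hTdef, map_sub, AlgHom.commutes]; rfl
    have hT : ∀ p, T (derivative p) = derivative (T p) := fun p => by
      rw [hTa, hTa, hcomm, derivative_sub, derivative_smul]
    have hT1 : T 1 = 0 := by rw [hTa, hone, smul_eq_C_mul, mul_one, sub_self]
    have hTX : T X = C ((T X).coeff 0) := by
      apply eq_C_of_derivative_eq_zero
      rw [← hT, derivative_X, hT1]
    have := eq_zero_of_commute_derivative_of_isAlgebraic T hT hT1 hTX (halg _)
    rw [this, C_0, hTa, sub_eq_zero] at hTX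
    exact hTX
  · refine ⟨(h • (X : k[X])).coeff 1, ?_⟩
    have h1 := hcomm h X
    simp only [zero_add, pow_one, derivative_X, mul_one] at h1
    ext j
    have h2 := congrArg (fun p => p.coeff j) h1
    rcases j with _ | _ | j
    · rw [h2]; simp
    · simp
    · rw [coeff_X_mul, coeff_derivative] at h2
      have h3 : (h • (X : k[X])).coeff (j + 1 + 1) * ((j + 1 : ℕ) : k) = 0 := by
        push_cast at h2 ⊢
        linear_combination -h2
      rw [(mul_eq_zero.1 h3).resolve_right (Nat.cast_ne_zero.2 j.succ_ne_zero)]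
      simp [coeff_X]
  · refine exists_apply_X_eq_smul (n + 1) n.succ_pos (smulAlgHom k H k[X] h) ?_ (halg h) ?_
    · exact LinearMap.ext fun p => hcomm h p
    · exact fun j hj => coeff_smul_X_eq_zero (n + 1) n.succ_pos hcomm h j hj

/-! ### Separating and independent functionals. -/

/-- A family of functionals separating the points of `V` separates those of `V ⊗ V`. -/
theorem TensorProduct.eq_zero_of_forall_mul'_map_eq_zero {k V ι : Type*} [Field k] [AddCommGroup V]
    [Module k V] (F : ι → V →ₗ[k] k) (hF : ∀ v, (∀ i, F i v = 0) → v = 0) (t : V ⊗[k] V)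
    (ht : ∀ i j, LinearMap.mul' k k (TensorProduct.map (F i) (F j) t) = 0) : t = 0 := by
  have hl : ∀ (f g : V →ₗ[k] k) (t : V ⊗[k] V), g (TensorProduct.lid k V (f.rTensor V t)) =
      LinearMap.mul' k k (TensorProduct.map f g t) := by
    intro f g t
    induction t using TensorProduct.induction_on with
    | zero => simp
    | tmul x y => simp
    | add x y hx hy => simp only [map_add, hx, hy]
  have hr : ∀ (f g : V →ₗ[k] k) (t : V ⊗[k] V), f (TensorProduct.rid k V (g.lTensor V t)) =
      LinearMap.mul' k k (TensorProduct.map f g t) := by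
    intro f g t
    induction t using TensorProduct.induction_on with
    | zero => simp
    | tmul x y => simp [mul_comm]
    | add x y hx hy => simp only [map_add, hx, hy]
  -- Slicing `t` by `F i` gives a vector killed by every `F j`, hence zero; this frees one factor,
  -- and then the other.
  have h1 : ∀ i (g : V →ₗ[k] k), LinearMap.mul' k k (TensorProduct.map (F i) g t) = 0 := by
    intro i g
    rw [← hl, hF _ fun j => (hl _ _ _).trans (ht i j), map_zero]
  have h2 : ∀ f g : V →ₗ[k] k, LinearMap.mul' k k (TensorProduct.map f g t) = 0 := by
    intro f g
    rw [← hr, hF _ fun i => (hr _ _ _).trans (h1 i g), map_zero]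
  let b := Module.Basis.ofVectorSpace k V
  apply (b.tensorProduct b).ext_elem
  rintro ⟨i, j⟩
  have h3 : ∀ t : V ⊗[k] V, (b.tensorProduct b).repr t (i, j) =
      LinearMap.mul' k k (TensorProduct.map (b.coord i) (b.coord j) t) := by
    intro t
    induction t using TensorProduct.induction_on with
    | zero => simp
    | tmul x y => simp [mul_comm]
    | add x y hx hy => simp [hx, hy]
  rw [h3, h2, map_zero, Finsupp.zero_apply]

/-- A linearly independent finite family of functionals is jointly surjective. -/
theorem LinearIndependent.surjective_pi {k V ι : Type*} [Field k] [AddCommGroup V]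
    [Module k V] [Finite ι] {F : ι → V →ₗ[k] k} (hF : LinearIndependent k F) :
    Function.Surjective (LinearMap.pi F) := by
  have := Fintype.ofFinite ι
  classical
  by_contra hsurj
  obtain ⟨φ, hφ0, hφ⟩ := (LinearMap.range (LinearMap.pi F)).exists_le_ker_of_lt_top
    (lt_top_iff_ne_top.2 fun h => hsurj (LinearMap.range_eq_top.1 h))
  have hφs : ∀ x, φ x = ∑ i, x i * φ (Pi.single i 1) := fun x => by
    conv_lhs => rw [pi_eq_sum_univ' x]
    simp
  have h0 := Fintype.linearIndependent_iff.1 hF (fun i => φ (Pi.single i 1)) (by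
    ext v
    have : φ (LinearMap.pi F v) = 0 := hφ ⟨v, rfl⟩
    rw [hφs] at this
    simpa [mul_comm] using this)
  exact hφ0 (LinearMap.ext fun x => by rw [hφs]; simp [h0])

/-! ### Powers of a character and group algebras. -/

section Character

variable {k H : Type*} [Field k] [Ring H]

instance finite_algHom_of_finiteDimensional [Algebra k H] [FiniteDimensional k H] :
    Finite (H →ₐ[k] k) :=
  (linearIndependent_algHom_toLinearMap k H k).finite_of_isNoetherian

variable [HopfAlgebra k H] (χ : WithConv (H →ₐ[k] k))

theorem mul'_map_pow_pow (i j : ℕ) (h : H) :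
    LinearMap.mul' k k (TensorProduct.map (χ ^ i).ofConv.toLinearMap (χ ^ j).ofConv.toLinearMap
      (Coalgebra.comul (R := k) h)) = (χ ^ (i + j)) h := by
  rw [pow_add]
  rfl

/-- Independence of characters leaves finitely many of them, so two powers of `χ` coincide; the
convolution inverse `χ ∘ S` allows cancellation. -/
theorem isOfFinOrder_character [FiniteDimensional k H] : IsOfFinOrder χ := by
  have : Finite (WithConv (H →ₐ[k] k)) := Finite.of_equiv _ (WithConv.equiv _).symm
  let lin : WithConv (H →ₐ[k] k) → WithConv (H →ₗ[k] k) := fun f => toConv f.ofConv.toLinearMap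
  have hinj : Function.Injective lin := fun f g h =>
    WithConv.ext (AlgHom.toLinearMap_injective (WithConv.toConv_injective h))
  have hcancel : ∀ f g : WithConv (H →ₐ[k] k), χ * f = χ * g → f = g := by
    intro f g h
    apply hinj
    have h1 : lin χ * lin f = lin χ * lin g := congrArg lin h
    have h2 := AlgHom.comp_antipode_convMul χ.ofConv
    have h3 := congrArg (toConv (χ.ofConv.toLinearMap ∘ₗ HopfAlgebra.antipode k) * ·) h1
    simp only [← mul_assoc] at h3
    change toConv _ * toConv _ * _ = toConv _ * toConv _ * _ at h3
    rwa [h2, one_mul, one_mul] at h3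
  have hpow : ∀ (i : ℕ) (f g : WithConv (H →ₐ[k] k)), χ ^ i * f = χ ^ i * g → f = g := by
    intro i
    induction i with
    | zero => simp
    | succ i ih =>
      intro f g h
      rw [pow_succ, mul_assoc, mul_assoc] at h
      exact hcancel _ _ (ih _ _ h)
  obtain ⟨i, j, hij, h⟩ := Finite.exists_ne_map_eq_of_infinite (fun i : ℕ => χ ^ i)
  wlog hlt : i < j generalizing i j
  · exact this j i hij.symm h.symm (by omega)
  rw [isOfFinOrder_iff_pow_eq_one]
  refine ⟨j - i, by omega, hpow i _ _ ?_⟩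
  rw [← pow_add, Nat.add_sub_cancel' hlt.le, mul_one]
  exact h.symm

/-- The common kernel of the convolution powers of a character. -/
noncomputable def powKer : Ideal H := ⨅ i : ℕ, RingHom.ker (χ ^ i).ofConv

theorem mem_powKer {h : H} : h ∈ powKer χ ↔ ∀ i : ℕ, (χ ^ i) h = 0 := by
  simp [powKer, RingHom.mem_ker]

theorem powKer_isTwoSided : (powKer χ).IsTwoSided :=
  ⟨fun b ha => by
    rw [mem_powKer] at *
    intro i
    rw [map_mul, ha i, zero_mul]⟩

/-- Composing with the antipode inverts `χ ^ i`; finite order writes the inverse as a natural power,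
so `powKer χ` is antipode-stable. -/
theorem character_pow_antipode [FiniteDimensional k H] (i : ℕ) (h : H) :
    (χ ^ i) (HopfAlgebra.antipode k h) = (χ ^ (i * (orderOf χ - 1))) h := by
  have hN : 0 < orderOf χ := (isOfFinOrder_character χ).orderOf_pos
  have h1 : χ ^ i * χ ^ (i * (orderOf χ - 1)) = 1 := by
    rw [← pow_add, add_comm, ← Nat.mul_succ, Nat.succ_eq_add_one, Nat.sub_add_cancel hN, mul_comm, pow_mul,
      pow_orderOf_eq_one, one_pow]
  have h2 : toConv (χ ^ i).ofConv.toLinearMap *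
      toConv (χ ^ (i * (orderOf χ - 1))).ofConv.toLinearMap = (1 : WithConv (H →ₗ[k] k)) :=
    congrArg (fun f : WithConv (H →ₐ[k] k) => toConv f.ofConv.toLinearMap) h1
  have h3 := left_inv_eq_right_inv (AlgHom.comp_antipode_convMul (χ ^ i).ofConv) h2
  exact congrArg (fun f => f.ofConv h) h3

theorem powKer_isHopfIdeal [FiniteDimensional k H] : (powKer χ).IsHopfIdeal k where
  counit_eq_zero x hx := by
    have := (mem_powKer χ).1 hx 0
    rwa [pow_zero] at this
  map_mkQ_comul_eq_zero x hx := by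
    let F : ℕ → (H ⧸ (powKer χ).restrictScalars k) →ₗ[k] k := fun i =>
      ((powKer χ).restrictScalars k).liftQ (χ ^ i).ofConv.toLinearMap
        fun y hy => (mem_powKer χ).1 hy i
    refine TensorProduct.eq_zero_of_forall_mul'_map_eq_zero F ?_ _ ?_
    · intro v hv
      obtain ⟨y, rfl⟩ := Submodule.mkQ_surjective _ v
      rw [Submodule.mkQ_apply, Submodule.Quotient.mk_eq_zero]
      exact (mem_powKer χ).2 hv
    · intro i j
      rw [← LinearMap.comp_apply (TensorProduct.map _ _), ← TensorProduct.map_comp]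
      exact (mul'_map_pow_pow χ i j x).trans ((mem_powKer χ).1 hx _)
  antipode_mem x hx := by
    rw [mem_powKer] at *
    intro i
    rw [character_pow_antipode]
    exact hx _

theorem HopfAlgebra.map_antipode_of_monoidAlgebra {R A G : Type*} [CommRing R] [Ring A]
    [HopfAlgebra R A] [Group G] (f : MonoidAlgebra R G →ₐc[R] A) (x : MonoidAlgebra R G) :
    f (HopfAlgebra.antipode R x) = HopfAlgebra.antipode R (f x) := by
  have h : f.toLinearMap ∘ₗ HopfAlgebra.antipode R = HopfAlgebra.antipode R ∘ₗ f.toLinearMap := by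
    ext g
    have hg : IsGroupLikeElem R (f (MonoidAlgebra.single g 1)) :=
      (MonoidAlgebra.isGroupLikeElem_single_one g).map f
    have h1 : f (MonoidAlgebra.single g⁻¹ 1) * f (MonoidAlgebra.single g 1) = 1 := by
      rw [← map_mul, MonoidAlgebra.single_mul_single, inv_mul_cancel, mul_one,
        ← MonoidAlgebra.one_def, map_one]
    have := left_inv_eq_right_inv h1 hg.mul_antipode_cancel
    simpa using! this
  exact LinearMap.congr_fun h x

/-- A Hopf algebra spanned by its group-like elements is a group algebra. -/
theorem isGroupAlgebra_of_span_groupLike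
    (h : Submodule.span k (Set.range (GroupLike.val (R := k) (A := H))) = ⊤) :
    IsGroupAlgebra k H := by
  let f : MonoidAlgebra k (GroupLike k H) →ₐc[k] H := MonoidAlgebra.liftGroupLikeBialgHom
  have hval : ∀ g : GroupLike k H, f (MonoidAlgebra.single g 1) = g := fun g => by simp [f]
  have hsurj : Function.Surjective f := by
    have : (⊤ : Submodule k H) ≤ LinearMap.range f.toLinearMap := by
      rw [← h, Submodule.span_le]
      rintro _ ⟨g, rfl⟩
      exact ⟨_, hval g⟩
    exact fun x => this (Submodule.mem_top (x := x))
  have hinj : Function.Injective f := by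
    refine LinearMap.injective_of_linearIndependent (f := f.toLinearMap)
      (v := fun g => MonoidAlgebra.single g 1) ?_ ?_
    · exact (MonoidAlgebra.basis (GroupLike k H) k).span_eq
    · rw [show f.toLinearMap ∘ (fun g => MonoidAlgebra.single g 1) = GroupLike.val from
        funext hval]
      exact linearIndep_groupLikeVal
  let e := BialgEquiv.ofBijective f ⟨hinj, hsurj⟩
  refine ⟨GroupLike k H, inferInstance, e.symm, fun x => ?_⟩
  obtain ⟨y, rfl⟩ := e.surjective x
  apply e.injective
  change e (e.symm (HopfAlgebra.antipode k (e y))) = e (HopfAlgebra.antipode k (e.symm (e y)))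
  rw [e.apply_symm_apply, e.symm_apply_apply]
  exact (HopfAlgebra.map_antipode_of_monoidAlgebra f y).symm

/-- A finite-dimensional Hopf algebra whose dual is spanned by the powers of a character is a group
algebra. -/
theorem isGroupAlgebra_of_powKer_eq_bot [IsAlgClosed k] [CharZero k] [FiniteDimensional k H]
    (hχ : powKer χ = ⊥) : IsGroupAlgebra k H := by
  have hfin := isOfFinOrder_character χ
  set N := orderOf χ with hN
  have hNpos : 0 < N := hfin.orderOf_pos
  have : NeZero N := ⟨hNpos.ne'⟩
  have : NeZero (N : k) := ⟨Nat.cast_ne_zero.2 hNpos.ne'⟩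
  obtain ⟨ζ, hζ⟩ := HasEnoughRootsOfUnity.exists_primitiveRoot k N
  let F : Fin N → H →ₗ[k] k := fun i => (χ ^ (i : ℕ)).ofConv.toLinearMap
  have hFind : LinearIndependent k F :=
    (linearIndependent_algHom_toLinearMap k H k).comp (fun i : Fin N => (χ ^ (i : ℕ)).ofConv)
      fun i j hij => Fin.ext (pow_injOn_Iio_orderOf i.2 j.2 (WithConv.ofConv_injective hij))
  have hsep : ∀ v : H, (∀ i : ℕ, (χ ^ i).ofConv.toLinearMap v = 0) → v = 0 := fun v hv => by
    have : v ∈ powKer χ := (mem_powKer χ).2 hv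
    rwa [hχ] at this
  have hFinj : Function.Injective (LinearMap.pi F) := by
    rw [← LinearMap.ker_eq_bot, LinearMap.ker_eq_bot']
    intro v hv
    refine hsep v fun i => ?_
    rw [← pow_mod_orderOf χ i]
    exact congrFun hv ⟨i % N, Nat.mod_lt _ hNpos⟩
  have hdim : Module.finrank k H = N := by
    rw [(LinearEquiv.ofBijective _ ⟨hFinj, hFind.surjective_pi⟩).finrank_eq]
    simp
  -- Values `ζ ^ i` make `i ↦ (χ ^ i) g` multiplicative in `i`, which is group-likeness tested
  -- against the powers of `χ`.
  obtain ⟨g, hg⟩ := hFind.surjective_pi fun i => ζ ^ (i : ℕ)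
  have hg' : ∀ i : ℕ, (χ ^ i) g = ζ ^ i := by
    intro i
    have h1 : ζ ^ i = ζ ^ (i % N) := by
      conv_lhs => rw [← Nat.mod_add_div i N, pow_add, pow_mul, hζ.pow_eq_one, one_pow, mul_one]
    rw [← pow_mod_orderOf χ i, h1]
    exact congrFun hg ⟨i % N, Nat.mod_lt _ hNpos⟩
  have hgl : IsGroupLikeElem k g := by
    refine ⟨by simpa using hg' 0, ?_⟩
    rw [← sub_eq_zero]
    refine TensorProduct.eq_zero_of_forall_mul'_map_eq_zero
      (fun i : ℕ => (χ ^ i).ofConv.toLinearMap) hsep _ fun i j => ?_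
    rw [map_sub, map_sub, mul'_map_pow_pow, hg', TensorProduct.map_tmul, LinearMap.mul'_apply]
    change _ - (χ ^ i) g * (χ ^ j) g = 0
    rw [hg', hg', pow_add, sub_self]
  let γ : GroupLike k H := ⟨g, hgl⟩
  have hχγ : ∀ i : ℕ, χ.ofConv (γ ^ i : GroupLike k H).val = ζ ^ i := by
    intro i
    have h1 : χ.ofConv g = ζ := by simpa using hg' 1
    rw [GroupLike.val_pow, map_pow, h1]
  -- `χ` separates these `N` powers because `ζ` is primitive; distinct group-likes are independent,
  -- so they fill dimension `N`.
  have hγ : LinearIndependent k fun i : Fin N => (γ ^ (i : ℕ)).val :=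
    linearIndep_groupLikeVal.comp (fun i : Fin N => γ ^ (i : ℕ)) fun i j hij => by
      refine Fin.ext (hζ.pow_inj i.2 j.2 ?_)
      rw [← hχγ, ← hχγ]
      exact congrArg (fun x : GroupLike k H => χ.ofConv x.val) hij
  apply isGroupAlgebra_of_span_groupLike
  rw [eq_top_iff, ← hγ.span_eq_top_of_card_eq_finrank' (by simp [hdim])]
  apply Submodule.span_mono
  rintro _ ⟨i, rfl⟩
  exact ⟨_, rfl⟩

end Character

/-! ### From scalar action on `X` to the theorem. -/

section ScalarAction

variable {k H : Type*} [Field k] [Ring H] [HopfAlgebra k H] [Module H k[X]]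
  [IsScalarTower k H k[X]]

/-- The character through which `H` acts on `X`, if it acts by scalars there. -/
noncomputable def smulXCharacter (hX : ∀ h : H, ∃ c : k, h • (X : k[X]) = c • X) : H →ₐ[k] k :=
  have hc : ∀ h : H, h • (X : k[X]) = (h • (X : k[X])).coeff 1 • X := fun h => by
    obtain ⟨c, hc⟩ := hX h
    rw [hc]
    simp
  AlgHom.ofLinearMap (lcoeff k 1 ∘ₗ (orbitMap k H X).ofConv) (by simp) fun a b => by
    change ((a * b) • (X : k[X])).coeff 1 = (a • (X : k[X])).coeff 1 * (b • (X : k[X])).coeff 1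
    rw [mul_smul, hc b, ← smulAlgHom_apply (R := k), map_smul, smulAlgHom_apply]
    simp [mul_comm]

theorem smul_X_eq_smulXCharacter (hX : ∀ h : H, ∃ c : k, h • (X : k[X]) = c • X) (h : H) :
    h • (X : k[X]) = smulXCharacter hX h • X := by
  obtain ⟨c, hc⟩ := hX h
  change _ = (h • (X : k[X])).coeff 1 • X
  rw [hc]
  simp

theorem smul_X_pow_eq [IsModuleAlgebra k H k[X]]
    (hX : ∀ h : H, ∃ c : k, h • (X : k[X]) = c • X) (i : ℕ) (h : H) :
    h • (X ^ i : k[X]) = ((toConv (smulXCharacter hX)) ^ i) h • X ^ i := by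
  induction i generalizing h with
  | zero =>
    rw [pow_zero, pow_zero, IsModuleAlgebra.smul_one_eq (R := k)]
    rfl
  | succ i ih =>
    let 𝓡 := Coalgebra.Repr.arbitrary k h
    have h1 : h • (X ^ (i + 1) : k[X]) = (orbitMap k H (X ^ i) * orbitMap k H (X : k[X])).ofConv h := by
      rw [← orbitMap_mul, ← pow_succ, orbitMap_apply]
    have h2 : ((toConv (smulXCharacter hX)) ^ (i + 1)) h =
        (toConv ((toConv (smulXCharacter hX)) ^ i).ofConv.toLinearMap *
          toConv (smulXCharacter hX).toLinearMap).ofConv h := by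
      rw [pow_succ]; rfl
    rw [h1, h2, 𝓡.convMul_apply, 𝓡.convMul_apply, Finset.sum_smul]
    refine Finset.sum_congr rfl fun j _ => ?_
    rw [orbitMap_apply, orbitMap_apply, ih, smul_X_eq_smulXCharacter hX, smul_mul_smul_comm,
      ← pow_succ]
    rfl

end ScalarAction

theorem corollary5p6 {H : Type*} [Ring H] [HopfAlgebra ℂ H] [FiniteDimensional ℂ H]
    [Module H ℂ[X]] [IsScalarTower ℂ H ℂ[X]] [IsModuleAlgebra ℂ H ℂ[X]]
    (hfaithful : IsInnerFaithful ℂ H ℂ[X])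
    (hcomm : ∃ m : ℕ, ∀ (h : H) (p : ℂ[X]),
      h • (Polynomial.X ^ m * Polynomial.derivative p) =
        Polynomial.X ^ m * Polynomial.derivative (h • p)) :
    IsGroupAlgebra ℂ H := by
  obtain ⟨m, hm⟩ := hcomm
  have hX := exists_smul_X_eq_smul (k := ℂ) m hm
  let χ := toConv (smulXCharacter hX)
  apply isGroupAlgebra_of_powKer_eq_bot χ
  by_contra hne
  obtain ⟨h, hh, v, hv⟩ := hfaithful _ (powKer_isTwoSided χ) (powKer_isHopfIdeal χ) hne
  apply hv
  have h0 : smulAlgHom ℂ H ℂ[X] h = 0 := by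
    refine Polynomial.lhom_ext' fun i => LinearMap.ext_ring ?_
    change h • (monomial i 1 : ℂ[X]) = 0
    rw [← X_pow_eq_monomial, smul_X_pow_eq hX, (mem_powKer χ).1 hh, zero_smul]
  rw [← smulAlgHom_apply (R := ℂ), h0, LinearMap.zero_apply]
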